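/- For a permutation $\sigma\in S_n$ write each cycle (fixed points are cycles of length one) as $C=(c_0,c_1,\dots,c_{p-1})$ with $c_{i+1}=\sigma(c_i)$ (indices modulo $p$) and $c_0$ the smallest element of $C$. Put $\mathrm{cdes}(C)=1+|\{0\le i<p-1: c_i>c_{i+1}\}|$, let $\mathrm{cdes}(\sigma)$ be the sum of $\mathrm{cdes}(C)$ over all cycles $C$ of $\sigma$, and let $\mathrm{cyc}(\sigma)$ be the number of cycles of $\sigma$. Say that $\sigma$ has a cycle $\{123,321\}$-match if in some cycle of length $p\ge 3$ there is an $r$ with $c_r<c_{r+1}<c_{r+2}$ or $c_r>c_{r+1}>c_{r+2}$, indices taken modulo $p$. Let $\mathcal{NCMS}_n$ be the set of $\sigma\in S_n$ with no cycle $\{123,321\}$-match, let $\mathcal{L}^{ncm}_n$ be the set of $n$-cycles in $\mathcal{NCMS}_n$, and let $$NCM_{\{123,321\}}(t,x,y)=1+\sum_{n\ge1}\frac{t^n}{n!}\sum_{\sigma\in\mathcal{NCMS}_n}x^{\mathrm{cyc}(\sigma)}y^{\mathrm{cdes}(\sigma)}.$$ **Theorem.** As formal power series in $t$, with $x$ and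 $\sqrt y$ indeterminates (or, more generally, elements of any commutative $\mathbb{Q}$-algebra, with $y=(\sqrt y)^2$), $$\sum_{n\ge1}\frac{t^n}{n!}\sum_{C\in\mathcal{L}^{ncm}_n}y^{\mathrm{cdes}(C)}=ty-\ln\cos(t\sqrt y)$$ and $$NCM_{\{123,321\}}(t,x,y)=e^{xyt}\,\bigl(\sec(t\sqrt y)\bigr)^x,$$ where for a power series $f$ in $t$ with constant term $1$, $\ln f=\sum_{k\ge1}\frac{(-1)^{k+1}}{k}(f-1)^k$ and $f^x=e^{x\ln f}$. -/

import Mathlib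

/-! Permutations of `{1, …, n}` are modelled by `Equiv.Perm (Fin n)` (labels shifted by one). Fixed
points count as cycles of length one. A cycle is written `(c₀, c₁, …, c_{p-1})` with
`c_i = σ^i c₀`, where `c₀` is its smallest element. -/

namespace CyclePattern

/-- Length of the cycle of `σ` containing `a` (equal to `1` for a fixed point). -/
noncomputable def cycleLength {n : ℕ} (σ : Equiv.Perm (Fin n)) (a : Fin n) : ℕ :=
  Function.minimalPeriod σ a

open Classical in
/-- The smallest elements of the cycles of `σ`; there is exactly one for each cycle. -/
noncomputable def cycleMins {n : ℕ} (σ : Equiv.Perm (Fin n)) : Finset (Fin n) :=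
  Finset.univ.filter fun c => ∀ b, σ.SameCycle c b → c ≤ b

/-- The number of cycles of `σ`. -/
noncomputable def cyc {n : ℕ} (σ : Equiv.Perm (Fin n)) : ℕ :=
  (cycleMins σ).card

/-- `cdes C = 1 + des (c₀ c₁ … c_{p-1})` for the cycle `C` of `σ` with smallest element `c₀ = c`. -/
noncomputable def cycleCdes {n : ℕ} (σ : Equiv.Perm (Fin n)) (c : Fin n) : ℕ :=
  1 + ((Finset.range (cycleLength σ c - 1)).filter
        fun i => (σ ^ (i + 1)) c < (σ ^ i) c).card

/-- `cdes σ`, the sum of `cdes C` over the cycles `C` of `σ`. -/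
noncomputable def cdes {n : ℕ} (σ : Equiv.Perm (Fin n)) : ℕ :=
  ∑ c ∈ cycleMins σ, cycleCdes σ c

/-- Reduction of a word with distinct letters: each letter is replaced by its rank among the
letters of the word, ranks being counted from `0`. -/
def red {n j : ℕ} (w : Fin j → Fin n) (i : Fin j) : ℕ :=
  (Finset.univ.filter fun k => w k < w i).card

/-- `σ` has a cycle `Υ`-match: in some cycle of length at least `j`, some `j` cyclically
consecutive entries `a, σ a, …, σ^(j-1) a` reduce to an element of `Υ`. -/
def HasCycleMatch {n j : ℕ} (Υ : Set (Equiv.Perm (Fin j))) (σ : Equiv.Perm (Fin n)) : Prop :=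
  ∃ a : Fin n, j ≤ cycleLength σ a ∧
    ∃ τ ∈ Υ, ∀ i : Fin j, red (fun s : Fin j => (σ ^ (s : ℕ)) a) i = (τ i : ℕ)

open Classical in
/-- The permutations of `S_n` without cycle `Υ`-matches. -/
noncomputable def ncmS {j : ℕ} (Υ : Set (Equiv.Perm (Fin j))) (n : ℕ) :
    Finset (Equiv.Perm (Fin n)) :=
  Finset.univ.filter fun σ => ¬ HasCycleMatch Υ σ

/-- The `n`-cycles of `S_n` (permutations with exactly one cycle) without cycle `Υ`-matches. -/
noncomputable def ncmL {j : ℕ} (Υ : Set (Equiv.Perm (Fin j))) (n : ℕ) :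
    Finset (Equiv.Perm (Fin n)) :=
  (ncmS Υ n).filter fun σ => cyc σ = 1

/-- `NCM_Υ(t, x, y) = 1 + ∑_{n ≥ 1} tⁿ/n! ∑_σ x^(cyc σ) y^(cdes σ)`, over the `σ ∈ S_n` without
cycle `Υ`-matches, as a power series in `t`. The empty permutation gives the constant term `1`. -/
noncomputable def NCM {R : Type*} [CommRing R] [Algebra ℚ R] {j : ℕ}
    (Υ : Set (Equiv.Perm (Fin j))) (x y : R) : PowerSeries R :=
  PowerSeries.mk fun n =>
    algebraMap ℚ R (1 / (n.factorial : ℚ)) * ∑ σ ∈ ncmS Υ n, x ^ cyc σ * y ^ cdes σ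

/-- `∑_{n ≥ 1} tⁿ/n! ∑_C y^(cdes C)`, over the `n`-cycles `C ∈ S_n` without cycle `Υ`-matches, as a
power series in `t`. The empty permutation has no cycle, so the constant term is `0`. -/
noncomputable def cycleNCM {R : Type*} [CommRing R] [Algebra ℚ R] {j : ℕ}
    (Υ : Set (Equiv.Perm (Fin j))) (y : R) : PowerSeries R :=
  PowerSeries.mk fun n =>
    algebraMap ℚ R (1 / (n.factorial : ℚ)) * ∑ σ ∈ ncmL Υ n, y ^ cdes σ

/-- The set of patterns `{123, 321}`: the identity and the reversal of `S_3`. -/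
def pat123_321 : Set (Equiv.Perm (Fin 3)) := {1, Fin.revPerm}

/-- The power `f^x = exp (x · ln f)` of a power series `f` with constant term `1`. -/
noncomputable def fpow {R : Type*} [CommRing R] [Algebra ℚ R] (f : PowerSeries R) (x : R) :
    PowerSeries R :=
  (PowerSeries.exp R).subst (PowerSeries.C x * PowerSeries.logOf f)

/-- `cos (s t)` as a power series in `t`. -/
noncomputable def cosS {R : Type*} [CommRing R] [Algebra ℚ R] (s : R) : PowerSeries R :=
  PowerSeries.rescale s (PowerSeries.cos R)

/-- `sec (s t) = 1 / cos (s t)` as a power series in `t`. -/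
noncomputable def secS {R : Type*} [CommRing R] [Algebra ℚ R] (s : R) : PowerSeries R :=
  PowerSeries.invOfUnit (cosS s) 1

end CyclePattern

/-! Avoiding 123 and 321 cyclically means that ascents and descents alternate along every cycle of
length at least two: each `a` is either fixed or a turn (`not_hasCycleMatch_iff`). Then `σ` maps
ascents to descents and conversely, so there are equally many of both, and `y ^ cdes σ` becomes a
product of local weights: `s` at each turn and `y = s²` at each fixed point (`prod_turnWt`). Such
weights factor over the cycles, so the exponential formula (`CycleWeight.totalGF_eq`) gives `exp (x
(y t + K))`, where `K` is the series of the cycles made of turns only.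

`K` is found without counting cycles. Weight the permutations made of turns only by the sign
`(-1)^cyc σ = (-1)^n sgn σ`; their series is then `exp (-K)`. The map `σ ↦ σ * swap 0 1` reverses
`sgn` and keeps every point a turn, unless `0` and `1` form a 2-cycle (`isTurn_mul_swap`). After
cancellation only the permutations with that 2-cycle remain, whence `total (n + 2) = -s² total n`
(`signWeight_total_add_two`). Hence `exp (-K) = cos (s t)`, that is, `K = -ln cos (s t) = ln sec (s
t)`. -/

namespace CyclePattern
open PowerSeries

/-! ### Exponential and logarithm of power series, by differential equations. -/

section ExpLog
variable {R : Type*} [CommRing R] [Algebra ℚ R]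

lemma constantCoeff_exp_subst {L : R⟦X⟧} (hL : constantCoeff L = 0) :
    constantCoeff ((exp R).subst L) = 1 := by
  have hs : HasSubst L := HasSubst.of_constantCoeff_zero' hL
  have h : (exp R) = 1 + (exp R - 1) := by ring
  have h0 : constantCoeff ((exp R - 1).subst L) = 0 :=
    constantCoeff_subst_eq_zero hL _ (by simp)
  rw [h, subst_add hs, map_add, h0, add_zero, ← coe_substAlgHom hs, map_one, map_one]

lemma derivative_exp_subst {L : R⟦X⟧} (hL : constantCoeff L = 0) :
    d⁄dX R ((exp R).subst L) = (exp R).subst L * d⁄dX R L := by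
  rw [derivative_subst (HasSubst.of_constantCoeff_zero' hL), derivative_exp]

lemma eq_of_derivative_eq {f g : R⟦X⟧} (hD : d⁄dX R f = d⁄dX R g)
    (hc : constantCoeff f = constantCoeff g) : f = g := by
  have : IsAddTorsionFree R := IsAddTorsionFree.of_module_rat R
  exact derivative.ext hD hc

/-- The product has derivative zero. With `P = exp L` this inverts `exp L`, which yields uniqueness
for `P' = L' P`. -/
lemma mul_exp_subst_neg_eq_one {P L : R⟦X⟧} (hL : constantCoeff L = 0)
    (hP : constantCoeff P = 1) (h : d⁄dX R P = d⁄dX R L * P) :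
    P * (exp R).subst (-L) = 1 := by
  have hL' : constantCoeff (-L) = 0 := by simp [hL]
  apply eq_of_derivative_eq
  · rw [Derivation.leibniz, derivative_exp_subst hL', h]
    simp only [map_neg, smul_eq_mul, Derivation.map_one_eq_zero]
    ring
  · simp [hP, constantCoeff_exp_subst hL']

lemma exp_subst_mul_exp_subst_neg {L : R⟦X⟧} (hL : constantCoeff L = 0) :
    (exp R).subst L * (exp R).subst (-L) = 1 :=
  mul_exp_subst_neg_eq_one hL (constantCoeff_exp_subst hL)
    (by rw [derivative_exp_subst hL, mul_comm])

lemma eq_exp_subst {P L : R⟦X⟧} (hL : constantCoeff L = 0)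
    (hP : constantCoeff P = 1) (h : d⁄dX R P = d⁄dX R L * P) : P = (exp R).subst L := by
  have h1 := mul_exp_subst_neg_eq_one hL hP h
  have h2 := exp_subst_mul_exp_subst_neg hL
  calc P = P * ((exp R).subst L * (exp R).subst (-L)) := by rw [h2, mul_one]
    _ = P * (exp R).subst (-L) * (exp R).subst L := by ring
    _ = _ := by rw [h1, one_mul]

lemma exp_subst_add {A B : R⟦X⟧} (hA : constantCoeff A = 0) (hB : constantCoeff B = 0) :
    (exp R).subst (A + B) = (exp R).subst A * (exp R).subst B := by
  symm
  apply eq_exp_subst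
  · simp [hA, hB]
  · simp [constantCoeff_exp_subst hA, constantCoeff_exp_subst hB]
  · rw [Derivation.leibniz, derivative_exp_subst hA, derivative_exp_subst hB]
    simp only [map_add, smul_eq_mul]
    ring

lemma rescale_exp_eq_subst (a : R) : rescale a (exp R) = (exp R).subst (C a * X) := by
  rw [rescale_eq_subst, smul_eq_C_mul]

/-- The identity `log' * (1 + X) = 1`, with `f - 1` substituted for `X`; the product form avoids
dividing by `f`. -/
lemma derivative_logOf_mul {f : R⟦X⟧} (hf : constantCoeff f = 1) :
    d⁄dX R (logOf f) * f = d⁄dX R f := by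
  have hs : HasSubst (f - 1) := HasSubst.of_constantCoeff_zero' (by simp [hf])
  have hg : d⁄dX R (log R) * (1 + X) = 1 := by
    rw [deriv_log]
    ext n
    cases n with
    | zero => simp [mul_add]
    | succ n => simp [mul_add, coeff_succ_mul_X, pow_succ, coeff_one]
  have h := congrArg (fun p => p.subst (f - 1)) hg
  simp only [← coe_substAlgHom hs, map_mul, map_add, map_one] at h
  rw [coe_substAlgHom hs, subst_X hs] at h
  rw [logOf_eq, derivative_subst hs]
  simp only [map_sub, Derivation.map_one_eq_zero, sub_zero]
  calc _ = (d⁄dX R (log R)).subst (f - 1) * (1 + (f - 1)) * d⁄dX R f := by ring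
    _ = _ := by rw [h, one_mul]

lemma logOf_exp_subst {L : R⟦X⟧} (hL : constantCoeff L = 0) :
    logOf ((exp R).subst L) = L := by
  have hc := constantCoeff_exp_subst hL
  apply eq_of_derivative_eq
  · have h := derivative_logOf_mul hc
    rw [derivative_exp_subst hL, mul_comm ((exp R).subst L)] at h
    have hu := exp_subst_mul_exp_subst_neg hL
    calc _ = d⁄dX R (logOf ((exp R).subst L)) * (exp R).subst L * (exp R).subst (-L) := by
          rw [mul_assoc, hu, mul_one]
      _ = _ := by rw [h, mul_assoc, hu, mul_one]
  · rw [constantCoeff_logOf hc, hL]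

end ExpLog

/-! ### Multiplicative weights; cycles under restriction and relabelling. -/

/-- A weight on the permutations of finite linear orders that is multiplicative over invariant
subsets and invariant under order isomorphisms. -/
structure CycleWeight (R : Type*) [CommRing R] where
  /-- The weight of a permutation. -/
  wt : ∀ {α : Type} [Fintype α] [LinearOrder α], Equiv.Perm α → R
  wt_subtypeCongr : ∀ {α : Type} [Fintype α] [LinearOrder α] (p : α → Prop) [DecidablePred p]
    (τ : Equiv.Perm {a // p a}) (ρ : Equiv.Perm {a // ¬ p a}),
    wt (Equiv.Perm.subtypeCongr τ ρ) = wt τ * wt ρ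
  wt_permCongr : ∀ {α β : Type} [Fintype α] [LinearOrder α] [Fintype β] [LinearOrder β]
    (e : α ≃o β) (σ : Equiv.Perm α), wt (e.toEquiv.permCongr σ) = wt σ

/-- All elements lie in the same cycle. -/
def IsTransitive {α : Type*} (σ : Equiv.Perm α) : Prop := ∀ a b, σ.SameCycle a b

lemma subtypeCongr_zpow_apply {α : Type*} {p : α → Prop} [DecidablePred p]
    (τ : Equiv.Perm {a // p a}) (ρ : Equiv.Perm {a // ¬ p a}) (k : ℤ) (a : {a // p a}) :
    (Equiv.Perm.subtypeCongr τ ρ ^ k) a = (τ ^ k) a := by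
  have h := map_zpow (Equiv.Perm.subtypeCongrHom p) (τ, ρ) k
  simp only [Equiv.Perm.subtypeCongrHom, MonoidHom.coe_mk, OneHom.coe_mk, Prod.pow_mk] at h
  rw [← h]
  simp [Equiv.Perm.subtypeCongr.left_apply_subtype]

lemma subtypeCongr_zpow_apply_neg {α : Type*} {p : α → Prop} [DecidablePred p]
    (τ : Equiv.Perm {a // p a}) (ρ : Equiv.Perm {a // ¬ p a}) (k : ℤ) (a : {a // ¬ p a}) :
    (Equiv.Perm.subtypeCongr τ ρ ^ k) a = (ρ ^ k) a := by
  have h := map_zpow (Equiv.Perm.subtypeCongrHom p) (τ, ρ) k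
  simp only [Equiv.Perm.subtypeCongrHom, MonoidHom.coe_mk, OneHom.coe_mk, Prod.pow_mk] at h
  rw [← h]
  simp [Equiv.Perm.subtypeCongr.right_apply_subtype]

lemma sameCycle_subtypeCongr {α : Type*} {p : α → Prop} [DecidablePred p]
    (τ : Equiv.Perm {a // p a}) (ρ : Equiv.Perm {a // ¬ p a}) (a : {a // p a}) (b : α) :
    (Equiv.Perm.subtypeCongr τ ρ).SameCycle a b ↔ ∃ h : p b, τ.SameCycle a ⟨b, h⟩ := by
  constructor
  · rintro ⟨k, rfl⟩
    rw [subtypeCongr_zpow_apply]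
    exact ⟨((τ ^ k) a).2, k, rfl⟩
  · rintro ⟨h, k, hk⟩
    exact ⟨k, by rw [subtypeCongr_zpow_apply, hk]⟩

lemma sameCycle_subtypeCongr_neg {α : Type*} {p : α → Prop} [DecidablePred p]
    (τ : Equiv.Perm {a // p a}) (ρ : Equiv.Perm {a // ¬ p a}) (a : {a // ¬ p a}) (b : α) :
    (Equiv.Perm.subtypeCongr τ ρ).SameCycle a b ↔ ∃ h : ¬ p b, ρ.SameCycle a ⟨b, h⟩ := by
  constructor
  · rintro ⟨k, rfl⟩
    rw [subtypeCongr_zpow_apply_neg]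
    exact ⟨((ρ ^ k) a).2, k, rfl⟩
  · rintro ⟨h, k, hk⟩
    exact ⟨k, by rw [subtypeCongr_zpow_apply_neg, hk]⟩

lemma permCongr_zpow_apply {α β : Type*} (e : α ≃ β) (σ : Equiv.Perm α) (k : ℤ) (a : α) :
    ((e.permCongr σ) ^ k) (e a) = e ((σ ^ k) a) := by
  have h := map_zpow e.permCongrHom σ k
  change e.permCongr (σ ^ k) = (e.permCongr σ) ^ k at h
  rw [← h]
  simp

lemma sameCycle_permCongr {α β : Type*} (e : α ≃ β) (σ : Equiv.Perm α) (a b : α) :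
    (e.permCongr σ).SameCycle (e a) (e b) ↔ σ.SameCycle a b := by
  simp only [Equiv.Perm.SameCycle, permCongr_zpow_apply, e.injective.eq_iff]

lemma isTransitive_permCongr {α β : Type*} (e : α ≃ β) (σ : Equiv.Perm α) :
    IsTransitive (e.permCongr σ) ↔ IsTransitive σ := by
  constructor
  · intro h a b
    exact (sameCycle_permCongr e σ a b).1 (h _ _)
  · intro h a b
    have := (sameCycle_permCongr e σ (e.symm a) (e.symm b)).2 (h _ _)
    simpa using this

/-! ### The exponential formula. -/

namespace CycleWeight
variable {R : Type*} [CommRing R] (W : CycleWeight R)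

/-- Total weight of the permutations of an `n`-element set. -/
noncomputable def total (n : ℕ) : R := ∑ σ : Equiv.Perm (Fin n), W.wt σ

open Classical in
/-- Total weight of the transitive permutations of an `n`-element set. -/
noncomputable def cyclic (n : ℕ) : R :=
  ∑ σ : Equiv.Perm (Fin n) with IsTransitive σ, W.wt σ

lemma sum_eq_total {α : Type} [Fintype α] [LinearOrder α] {n : ℕ} (h : Fintype.card α = n) :
    ∑ σ : Equiv.Perm α, W.wt σ = W.total n := by
  let e : α ≃o Fin n := (Fintype.orderIsoFinOfCardEq α h).symm
  rw [total]
  exact Fintype.sum_equiv e.toEquiv.permCongr _ _ fun σ => (W.wt_permCongr e σ).symm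

open Classical in
lemma sum_eq_cyclic {α : Type} [Fintype α] [LinearOrder α] {n : ℕ} (h : Fintype.card α = n) :
    ∑ σ : Equiv.Perm α with IsTransitive σ, W.wt σ = W.cyclic n := by
  let e : α ≃o Fin n := (Fintype.orderIsoFinOfCardEq α h).symm
  rw [cyclic]
  refine Finset.sum_equiv e.toEquiv.permCongr ?_ fun σ _ => (W.wt_permCongr e σ).symm
  intro σ
  simp [isTransitive_permCongr]

open Classical in
/-- The total weight of the permutations in which the cycle of `a` is the set `S`. -/
lemma sum_cycle_eq {n : ℕ} (a : Fin n) (S : Finset (Fin n)) (ha : a ∈ S) :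
    ∑ σ : Equiv.Perm (Fin n) with Finset.univ.filter (σ.SameCycle a) = S, W.wt σ =
      W.cyclic S.card * W.total (n - S.card) := by
  have h1 : Fintype.card {b // b ∈ S} = S.card := by simp
  have h2 : Fintype.card {b // b ∉ S} = n - S.card := by
    rw [Fintype.card_subtype_compl]; simp
  rw [← W.sum_eq_cyclic h1, ← W.sum_eq_total h2, Finset.sum_mul_sum, ← Finset.sum_product']
  symm
  -- Such a `σ` amounts to a transitive permutation of `S` together with an arbitrary permutation of
  -- the complement.
  refine Finset.sum_bij (fun q _ => Equiv.Perm.subtypeCongr q.1 q.2) ?_ ?_ ?_ ?_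
  · rintro ⟨τ, ρ⟩ h
    simp only [Finset.mem_product, Finset.mem_filter, Finset.mem_univ, true_and, and_true] at h ⊢
    ext b
    have := sameCycle_subtypeCongr τ ρ ⟨a, ha⟩ b
    simp only [Finset.mem_filter, Finset.mem_univ, true_and]
    rw [this]
    exact ⟨fun h => h.1, fun hb => ⟨hb, h _ _⟩⟩
  · rintro q - q' - h
    exact Equiv.Perm.subtypeCongrHom_injective (· ∈ S) h
  · intro σ hσ
    simp only [Finset.mem_filter, Finset.mem_univ, true_and] at hσ
    have hm : ∀ b, b ∈ S ↔ σ.SameCycle a b := by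
      intro b
      rw [← hσ]
      simp
    have hp : ∀ b, σ b ∈ S ↔ b ∈ S := by
      intro b
      rw [hm, hm, Equiv.Perm.sameCycle_apply_right]
    have hE : Equiv.Perm.subtypeCongr (σ.subtypePerm hp)
        (σ.subtypePerm (p := (· ∉ S)) fun b => not_congr (hp b)) = σ := by
      ext b
      by_cases hb : b ∈ S
      · rw [Equiv.Perm.subtypeCongr.left_apply _ _ hb]; simp
      · rw [Equiv.Perm.subtypeCongr.right_apply _ _ hb]; simp
    refine ⟨(σ.subtypePerm hp, σ.subtypePerm fun b => not_congr (hp b)), ?_, hE⟩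
    simp only [Finset.mem_product, Finset.mem_filter, Finset.mem_univ, true_and, and_true]
    rintro b c
    have hbc : σ.SameCycle b c := ((hm b).1 b.2).symm.trans ((hm c).1 c.2)
    rw [← hE] at hbc
    obtain ⟨_, h⟩ := (sameCycle_subtypeCongr _ _ b c).1 hbc
    exact h
  · rintro ⟨τ, ρ⟩ -
    convert (W.wt_subtypeCongr (· ∈ S) τ ρ).symm

/-- Classify by the cycle of `0`: its `k` other elements are chosen among the `n` nonzero ones. -/
lemma total_succ (n : ℕ) :
    W.total (n + 1) =
      ∑ k ∈ Finset.range (n + 1), (n.choose k : R) * (W.cyclic (k + 1) * W.total (n - k)) := by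
  classical
  rw [total, ← Finset.sum_fiberwise (s := Finset.univ)
    (g := fun σ : Equiv.Perm (Fin (n + 1)) => Finset.univ.filter (σ.SameCycle 0))]
  have hu : (Finset.univ : Finset (Finset (Fin (n + 1)))) =
      (insert (0 : Fin (n + 1)) (Finset.univ.erase 0)).powerset := by
    rw [Finset.insert_erase (Finset.mem_univ _)]; simp
  -- Sets that omit `0` contribute nothing, since `0` lies in its own cycle.
  rw [hu, Finset.sum_powerset_insert (Finset.notMem_erase _ _), Finset.sum_eq_zero, zero_add]
  · have hc : (Finset.univ.erase (0 : Fin (n + 1))).card = n := by simp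
    have h := Finset.sum_powerset_apply_card
      (fun k => W.cyclic (k + 1) * W.total (n - k)) (x := Finset.univ.erase (0 : Fin (n + 1)))
    rw [hc] at h
    simp only [nsmul_eq_mul] at h
    rw [← h]
    refine Finset.sum_congr rfl fun S hS => ?_
    have h0 : (0 : Fin (n + 1)) ∉ S := fun h0 =>
      Finset.notMem_erase _ _ (Finset.mem_powerset.1 hS h0)
    rw [W.sum_cycle_eq 0 _ (Finset.mem_insert_self _ _), Finset.card_insert_of_notMem h0,
      Nat.add_sub_add_right]
  · intro S hS
    have h0 : (0 : Fin (n + 1)) ∉ S := fun h0 =>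
      Finset.notMem_erase _ _ (Finset.mem_powerset.1 hS h0)
    rw [Finset.filter_eq_empty_iff.2, Finset.sum_empty]
    rintro σ - rfl
    exact h0 (by simp [Equiv.Perm.SameCycle.refl])

variable [Algebra ℚ R]

/-- Exponential generating function of the total weights. -/
noncomputable def totalGF : R⟦X⟧ :=
  PowerSeries.mk fun n => algebraMap ℚ R (1 / (n.factorial : ℚ)) * W.total n

/-- Exponential generating function of the weights of the nonempty transitive permutations. -/
noncomputable def cyclicGF : R⟦X⟧ :=
  PowerSeries.mk fun n => if n = 0 then 0 else algebraMap ℚ R (1 / (n.factorial : ℚ)) * W.cyclic n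

lemma constantCoeff_cyclicGF : constantCoeff W.cyclicGF = 0 := by
  rw [← coeff_zero_eq_constantCoeff_apply, cyclicGF, coeff_mk, if_pos rfl]

lemma inv_factorial_succ_mul (n : ℕ) :
    algebraMap ℚ R (1 / ((n + 1).factorial : ℚ)) * ((n : R) + 1) =
      algebraMap ℚ R (1 / (n.factorial : ℚ)) := by
  have h : ((n : R) + 1) = algebraMap ℚ R (n + 1) := by simp
  rw [h, ← map_mul]
  congr 1
  have := Nat.factorial_ne_zero n
  rw [Nat.factorial_succ]
  push_cast
  field_simp

/-- The exponential formula. -/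
theorem totalGF_eq (h0 : W.total 0 = 1) : W.totalGF = (exp R).subst W.cyclicGF := by
  refine eq_exp_subst W.constantCoeff_cyclicGF ?_ ?_
  · rw [← coeff_zero_eq_constantCoeff_apply, totalGF, coeff_mk, h0]
    simp
  -- Divided by `n!`, the recurrence `total_succ` is the coefficient form of `P' = L' P`.
  · ext n
    rw [coeff_derivative, coeff_mul, Finset.Nat.sum_antidiagonal_eq_sum_range_succ_mk, totalGF,
      coeff_mk, mul_right_comm, inv_factorial_succ_mul, W.total_succ, Finset.mul_sum]
    refine Finset.sum_congr rfl fun k hk => ?_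
    have hk' : k ≤ n := Nat.lt_succ_iff.1 (Finset.mem_range.1 hk)
    simp only [coeff_derivative, cyclicGF, coeff_mk, Nat.succ_ne_zero, if_false]
    rw [mul_right_comm _ _ ((k : R) + 1), inv_factorial_succ_mul]
    have hc : algebraMap ℚ R (1 / (n.factorial : ℚ)) * (n.choose k : R) =
        algebraMap ℚ R (1 / (k.factorial : ℚ)) * algebraMap ℚ R (1 / ((n - k).factorial : ℚ)) := by
      have h : (n.choose k : R) = algebraMap ℚ R (n.choose k) := by simp
      rw [h, ← map_mul, ← map_mul, Nat.cast_choose ℚ hk']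
      congr 1
      have h1 := Nat.factorial_ne_zero n
      field_simp
    rw [← mul_assoc, hc]
    ring

end CycleWeight

/-! ### Local weights on turns, fixed points and cycle minima. -/

section Weights
variable {R : Type*} [CommRing R]

/-- `a, σ a, σ (σ a)` is not monotone and `a` is not fixed. -/
def IsTurn {α : Type*} [LinearOrder α] (σ : Equiv.Perm α) (a : α) : Prop :=
  (a < σ a ∧ σ (σ a) < σ a) ∨ (σ a < a ∧ σ a < σ (σ a))

lemma IsTurn.apply_ne {α : Type*} [LinearOrder α] {σ : Equiv.Perm α} {a : α}
    (h : IsTurn σ a) : σ a ≠ a := by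
  rcases h with h | h
  · exact h.1.ne'
  · exact h.1.ne

open Classical in
/-- The local weight: `f` at a fixed point, `s` at a turn and `0` elsewhere. -/
noncomputable def turnWt {α : Type*} [LinearOrder α] (f s : R) (σ : Equiv.Perm α) (a : α) : R :=
  if σ a = a then f else if IsTurn σ a then s else 0

open Classical in
/-- The local weight `x` at the cycle minima, and `1` elsewhere. -/
noncomputable def minWt {α : Type*} [LinearOrder α] (x : R) (σ : Equiv.Perm α) (a : α) : R :=
  if ∀ b, σ.SameCycle a b → a ≤ b then x else 1

section Restrict
variable {α : Type} [LinearOrder α] (p : α → Prop) [DecidablePred p]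
    (τ : Equiv.Perm {a // p a}) (ρ : Equiv.Perm {a // ¬ p a})

lemma turnWt_subtypeCongr (f s : R) (a : {a // p a}) :
    turnWt f s (Equiv.Perm.subtypeCongr τ ρ) a = turnWt f s τ a := by
  simp only [turnWt, IsTurn, Equiv.Perm.subtypeCongr.left_apply_subtype, Subtype.coe_lt_coe,
    Subtype.coe_inj]
  congr

lemma turnWt_subtypeCongr_neg (f s : R) (a : {a // ¬ p a}) :
    turnWt f s (Equiv.Perm.subtypeCongr τ ρ) a = turnWt f s ρ a := by
  simp only [turnWt, IsTurn, Equiv.Perm.subtypeCongr.right_apply_subtype, Subtype.coe_lt_coe,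
    Subtype.coe_inj]
  congr

lemma minWt_subtypeCongr (x : R) (a : {a // p a}) :
    minWt x (Equiv.Perm.subtypeCongr τ ρ) a = minWt x τ a := by
  classical
  refine if_congr ⟨fun h b hb => ?_, fun h b hb => ?_⟩ rfl rfl
  · exact h b ((sameCycle_subtypeCongr τ ρ a b).2 ⟨b.2, hb⟩)
  · obtain ⟨hp, hs⟩ := (sameCycle_subtypeCongr τ ρ a b).1 hb
    exact h ⟨b, hp⟩ hs

lemma minWt_subtypeCongr_neg (x : R) (a : {a // ¬ p a}) :
    minWt x (Equiv.Perm.subtypeCongr τ ρ) a = minWt x ρ a := by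
  classical
  refine if_congr ⟨fun h b hb => ?_, fun h b hb => ?_⟩ rfl rfl
  · exact h b ((sameCycle_subtypeCongr_neg τ ρ a b).2 ⟨b.2, hb⟩)
  · obtain ⟨hp, hs⟩ := (sameCycle_subtypeCongr_neg τ ρ a b).1 hb
    exact h ⟨b, hp⟩ hs

lemma prod_turnWt_subtypeCongr [Fintype α] (f s : R) :
    ∏ a, turnWt f s (Equiv.Perm.subtypeCongr τ ρ) a =
      (∏ a, turnWt f s τ a) * ∏ a, turnWt f s ρ a := by
  rw [← Fintype.prod_subtype_mul_prod_subtype p]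
  simp only [turnWt_subtypeCongr, turnWt_subtypeCongr_neg]

lemma prod_minWt_subtypeCongr [Fintype α] (x : R) :
    ∏ a, minWt x (Equiv.Perm.subtypeCongr τ ρ) a = (∏ a, minWt x τ a) * ∏ a, minWt x ρ a := by
  rw [← Fintype.prod_subtype_mul_prod_subtype p]
  simp only [minWt_subtypeCongr, minWt_subtypeCongr_neg]

end Restrict

section Transport
variable {α β : Type} [Fintype α] [LinearOrder α] [Fintype β] [LinearOrder β]
    (e : α ≃o β) (σ : Equiv.Perm α)

lemma prod_turnWt_permCongr (f s : R) :
    ∏ b, turnWt f s (e.toEquiv.permCongr σ) b = ∏ a, turnWt f s σ a := by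
  symm
  refine Fintype.prod_equiv e.toEquiv _ _ fun a => ?_
  simp [turnWt, IsTurn]
  congr

lemma prod_minWt_permCongr (x : R) :
    ∏ b, minWt x (e.toEquiv.permCongr σ) b = ∏ a, minWt x σ a := by
  symm
  refine Fintype.prod_equiv e.toEquiv _ _ fun a => ?_
  simp only [minWt]
  congr 1
  rw [e.toEquiv.surjective.forall]
  simp only [sameCycle_permCongr]
  simp

end Transport

/-- The weight `x ^ cyc σ * ∏ a, turnWt f s σ a`. -/
noncomputable def turnWeight (x f s : R) : CycleWeight R where
  wt σ := (∏ a, minWt x σ a) * ∏ a, turnWt f s σ a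
  wt_subtypeCongr p _ τ ρ := by
    rw [prod_minWt_subtypeCongr, prod_turnWt_subtypeCongr]
    ring
  wt_permCongr e σ := by rw [prod_minWt_permCongr, prod_turnWt_permCongr]

/-- The signed weight of the permutations all of whose elements are turns. -/
noncomputable def signWeight (s : R) : CycleWeight R where
  wt {α} _ _ σ := (-1) ^ Fintype.card α * ((Equiv.Perm.sign σ : ℤ) : R) * ∏ a, turnWt 0 s σ a
  wt_subtypeCongr {α} _ _ p _ τ ρ := by
    have hc : Fintype.card α = Fintype.card {a // p a} + Fintype.card {a // ¬ p a} := by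
      rw [← Fintype.card_sum]
      exact Fintype.card_congr (Equiv.sumCompl p).symm
    rw [prod_turnWt_subtypeCongr, Equiv.Perm.sign_subtypeCongr, hc, pow_add]
    have key : ∀ A B u v P Q : R, A * B * (u * v) * (P * Q) = (A * u * P) * (B * v * Q) := by
      intros
      ring
    push_cast
    rw [key]
    congr!
  wt_permCongr e σ := by
    rw [prod_turnWt_permCongr, Equiv.Perm.sign_permCongr, Fintype.card_congr e.toEquiv]

lemma prod_minWt_of_isTransitive {n : ℕ} (x : R) {σ : Equiv.Perm (Fin (n + 1))}
    (hσ : IsTransitive σ) : ∏ a, minWt x σ a = x := by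
  rw [Finset.prod_eq_single 0]
  · simp [minWt]
  · rintro a - ha
    rw [minWt, if_neg]
    intro h
    exact ha (Fin.le_zero_iff.1 (h 0 (hσ _ _)))
  · simp

lemma IsTransitive.apply_ne {n : ℕ} {σ : Equiv.Perm (Fin (n + 2))} (hσ : IsTransitive σ)
    (a : Fin (n + 2)) : σ a ≠ a := by
  intro h
  obtain ⟨b, hb⟩ := exists_ne a
  exact hb ((hσ a b).eq_of_left h).symm

/-- An `m`-cycle has sign `(-1)^(m-1)`. One point is treated apart, because `IsCycle` excludes the
identity. -/
lemma sign_of_isTransitive {n : ℕ} {σ : Equiv.Perm (Fin (n + 1))} (hσ : IsTransitive σ) :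
    (-1) ^ (n + 1) * ((Equiv.Perm.sign σ : ℤ) : R) = -1 := by
  cases n with
  | zero =>
    have h : σ = 1 := Equiv.ext fun i => Subsingleton.elim (α := Fin 1) _ _
    simp [h]
  | succ n =>
    have hc : σ.IsCycle := ⟨0, hσ.apply_ne 0, fun b _ => hσ 0 b⟩
    have hs : σ.support = Finset.univ := by
      ext a
      simp [hσ.apply_ne a]
    rw [hc.sign, hs, Finset.card_univ, Fintype.card_fin]
    push_cast
    rw [mul_neg, ← mul_pow]
    simp

lemma turnWeight_cyclic_succ (x f s : R) (n : ℕ) :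
    (turnWeight x f s).cyclic (n + 1) = x * (turnWeight 1 f s).cyclic (n + 1) := by
  classical
  rw [CycleWeight.cyclic, CycleWeight.cyclic, Finset.mul_sum]
  refine Finset.sum_congr rfl fun σ hσ => ?_
  have h := (Finset.mem_filter.1 hσ).2
  simp only [turnWeight, prod_minWt_of_isTransitive _ h, one_mul]

lemma signWeight_cyclic_succ (s : R) (n : ℕ) :
    (signWeight s).cyclic (n + 1) = - (turnWeight 1 0 s).cyclic (n + 1) := by
  classical
  rw [CycleWeight.cyclic, CycleWeight.cyclic, ← Finset.sum_neg_distrib]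
  refine Finset.sum_congr rfl fun σ hσ => ?_
  have h := (Finset.mem_filter.1 hσ).2
  simp only [turnWeight, signWeight, prod_minWt_of_isTransitive _ h, one_mul, Fintype.card_fin,
    sign_of_isTransitive h, neg_one_mul]

/-- A transitive permutation of at least two points fixes none, so the fixed-point weight never
enters. -/
lemma turnWeight_cyclic_add_two (f f' s : R) (n : ℕ) :
    (turnWeight 1 f s).cyclic (n + 2) = (turnWeight 1 f' s).cyclic (n + 2) := by
  classical
  refine Finset.sum_congr rfl fun σ hσ => ?_
  have h := (Finset.mem_filter.1 hσ).2
  simp only [turnWeight, turnWt, h.apply_ne, if_false]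

lemma turnWeight_cyclic_one (f s : R) : (turnWeight 1 f s).cyclic 1 = f := by
  classical
  have hu : (Finset.univ.filter (fun σ : Equiv.Perm (Fin 1) => IsTransitive σ)) = {1} := by
    ext σ
    simp [Subsingleton.elim σ 1, IsTransitive, Subsingleton.elim _ (0 : Fin 1)]
  rw [CycleWeight.cyclic, hu]
  simp [turnWeight, turnWt, minWt]

lemma turnWeight_total_zero (x f s : R) : (turnWeight x f s).total 0 = 1 := by
  simp [CycleWeight.total, turnWeight]

lemma signWeight_total_zero (s : R) : (signWeight s).total 0 = 1 := by
  simp [CycleWeight.total, signWeight]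

lemma signWeight_total_one (s : R) : (signWeight s).total 1 = 0 := by
  simp [CycleWeight.total, signWeight, turnWt]

lemma turnWeight_cyclic_two (f s : R) : (turnWeight 1 f s).cyclic 2 = s ^ 2 := by
  classical
  have hu : (Finset.univ.filter (fun σ : Equiv.Perm (Fin 2) => IsTransitive σ)) =
      {Equiv.swap 0 1} := by
    ext σ
    simp only [Finset.mem_filter, Finset.mem_univ, true_and, Finset.mem_singleton]
    constructor
    · intro h
      have h0 := h.apply_ne 0
      have h1 := h.apply_ne 1
      have h0' : σ 0 = 1 := by rw [Ne, Fin.ext_iff] at h0; rw [Fin.ext_iff]; simp at h0 ⊢; omega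
      have h1' : σ 1 = 0 := by rw [Ne, Fin.ext_iff] at h1; rw [Fin.ext_iff]; simp at h1 ⊢; omega
      refine Equiv.ext fun i => ?_
      fin_cases i
      · simpa using h0'
      · simpa using h1'
    · rintro rfl
      have h : (Equiv.swap (0 : Fin 2) 1).SameCycle 0 1 := ⟨1, by simp⟩
      intro a b
      fin_cases a <;> fin_cases b
      · exact Equiv.Perm.SameCycle.refl _ _
      · exact h
      · exact h.symm
      · exact Equiv.Perm.SameCycle.refl _ _
  rw [CycleWeight.cyclic, hu]
  simp [turnWeight, turnWt, minWt, IsTurn, Fin.prod_univ_two, sq]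

lemma signWeight_cyclic_two (s : R) : (signWeight s).cyclic 2 = - s ^ 2 := by
  rw [signWeight_cyclic_succ, turnWeight_cyclic_two]

lemma prod_turnWt_zero_eq {n : ℕ} (s : R) {σ : Equiv.Perm (Fin n)} (h : ∀ a, IsTurn σ a) :
    ∏ a, turnWt 0 s σ a = s ^ n := by
  simp [turnWt, h, fun a => (h a).apply_ne]

lemma isTurn_of_prod_ne_zero {n : ℕ} {s : R} {σ : Equiv.Perm (Fin n)}
    (h : ∏ a, turnWt 0 s σ a ≠ 0) (a : Fin n) : IsTurn σ a := by
  by_contra ha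
  exact h (Finset.prod_eq_zero (Finset.mem_univ a) (by simp [turnWt, ha]))

/-! ### The sign-reversing involution and the cosine. -/

/-- Outside the excluded case neither of `0, 1` maps into `{0, 1}`, so both are valleys below all
other values. Exchanging their successors then preserves every comparison that a turn involves. -/
lemma isTurn_mul_swap {n : ℕ} {σ : Equiv.Perm (Fin (n + 2))} (h : ∀ a, IsTurn σ a)
    (hne : ¬ (σ 0 = 1 ∧ σ 1 = 0)) (a : Fin (n + 2)) :
    IsTurn (σ * Equiv.swap 0 1) a := by
  have h01 : (0 : Fin (n + 2)) ≠ 1 := by simp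
  have hlt : ∀ b : Fin (n + 2), b ≠ 0 → b ≠ 1 → 1 < b := by
    intro b hb0 hb1
    exact lt_of_le_of_ne (Fin.one_le_of_ne_zero hb0) hb1.symm
  have hpos : ∀ b : Fin (n + 2), ¬ b < 0 := fun b => Fin.not_lt_zero b
  have h1 : σ 1 ≠ 0 := by
    intro h1
    -- If `1` maps to `0`, a predecessor `q > 1` of `1` would give the decreasing triple `q, 1, 0`.
    obtain ⟨q, hq⟩ := σ.surjective 1
    have hq0 : q ≠ 0 := fun hq0 => hne ⟨hq0 ▸ hq, h1⟩
    have hq1 : q ≠ 1 := by rintro rfl; exact h01 (h1.symm.trans hq)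
    have := h q
    rw [IsTurn, hq, h1] at this
    rcases this with h' | h'
    · exact absurd h'.1 (hlt q hq0 hq1).not_gt
    · exact hpos _ h'.2
  have h11 : σ 1 ≠ 1 := (h 1).apply_ne
  have h00 : σ 0 ≠ 0 := (h 0).apply_ne
  have hs1 : 1 < σ 1 := hlt _ h1 h11
  have h10 : σ 0 ≠ 1 := by
    intro h10
    have := h 0
    rw [IsTurn, h10] at this
    rcases this with h' | h'
    · exact absurd h'.2 hs1.not_gt
    · exact hpos _ h'.1
  have hs0 : 1 < σ 0 := hlt _ h00 h10
  have hz : (0 : Fin (n + 2)) < 1 := by simp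
  have e0 : (σ * Equiv.swap 0 1 : Equiv.Perm (Fin (n + 2))) 0 = σ 1 := by simp
  have e1 : (σ * Equiv.swap 0 1 : Equiv.Perm (Fin (n + 2))) 1 = σ 0 := by simp
  have e2 : ∀ b, b ≠ 0 → b ≠ 1 → (σ * Equiv.swap 0 1 : Equiv.Perm (Fin (n + 2))) b = σ b := by
    intro b hb0 hb1
    simp [Equiv.swap_apply_of_ne_of_ne hb0 hb1]
  have t0 := h 0
  have t1 := h 1
  have ta := h a
  rcases eq_or_ne a 0 with rfl | ha0
  · rw [IsTurn, e0, e2 _ h1 h11]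
    rw [IsTurn] at t1
    rcases t1 with t1 | t1
    · exact Or.inl ⟨hz.trans t1.1, t1.2⟩
    · exact absurd t1.1 hs1.not_gt
  rcases eq_or_ne a 1 with rfl | ha1
  · rw [IsTurn, e1, e2 _ h00 h10]
    rw [IsTurn] at t0
    rcases t0 with t0 | t0
    · exact Or.inl ⟨hs0, t0.2⟩
    · exact absurd t0.1 (hpos _)
  have h1a := hlt a ha0 ha1
  rw [IsTurn, e2 a ha0 ha1]
  rcases eq_or_ne (σ a) 0 with hb0 | hb0
  · rw [hb0, e0]
    exact Or.inr ⟨hz.trans h1a, hz.trans hs1⟩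
  rcases eq_or_ne (σ a) 1 with hb1 | hb1
  · rw [hb1, e1]
    exact Or.inr ⟨h1a, hs0⟩
  rw [e2 _ hb0 hb1]
  exact ta

lemma sum_signWeight_eq_zero {n : ℕ} (s : R) (p : Equiv.Perm (Fin (n + 2)) → Prop)
    [DecidablePred p] (hp : ∀ σ, p σ ↔ (σ 0 = 1 ∧ σ 1 = 0)) :
    ∑ σ : Equiv.Perm (Fin (n + 2)) with ¬ p σ, (signWeight s).wt σ = 0 := by
  classical
  -- Fixed points have weight `0` here, so only permutations made of turns contribute.
  have hsub : ∑ σ ∈ (Finset.univ.filter (fun σ => ¬ p σ)).filter (fun σ => ∀ a, IsTurn σ a),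
      (signWeight s).wt σ =
      ∑ σ : Equiv.Perm (Fin (n + 2)) with ¬ p σ, (signWeight s).wt σ := by
    refine Finset.sum_filter_of_ne fun σ _ h a => ?_
    exact isTurn_of_prod_ne_zero (s := s) (right_ne_zero_of_mul h) a
  rw [← hsub]
  have key : ∀ σ ∈ (Finset.univ.filter (fun σ => ¬ p σ)).filter (fun σ => ∀ a, IsTurn σ a),
      ∀ a, IsTurn (σ * Equiv.swap 0 1) a := by
    intro σ hσ
    simp only [Finset.mem_filter, Finset.mem_univ, true_and, hp] at hσ
    exact isTurn_mul_swap hσ.2 hσ.1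
  refine Finset.sum_involution (fun σ _ => σ * Equiv.swap 0 1) ?_ ?_ ?_ ?_
  · intro σ hσ
    have h1 := key σ hσ
    have h2 := (Finset.mem_filter.1 hσ).2
    simp only [signWeight, prod_turnWt_zero_eq s h1, prod_turnWt_zero_eq s h2, map_mul]
    rw [Equiv.Perm.sign_swap (by simp)]
    push_cast
    ring
  · intro σ hσ _ he
    have : Equiv.swap (0 : Fin (n + 2)) 1 = 1 := by simpa only [mul_eq_left] using he
    rw [Equiv.swap_eq_one_iff] at this
    simp at this
  · intro σ hσ
    have h2 := (Finset.mem_filter.1 hσ).2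
    simp only [Finset.mem_filter, Finset.mem_univ, true_and]
    refine ⟨?_, key σ hσ⟩
    rw [hp]
    rintro ⟨h, -⟩
    exact (h2 1).apply_ne (by simpa using h)
  · intro σ _
    simp [mul_assoc]

lemma cycle_zero_eq_iff {n : ℕ} (σ : Equiv.Perm (Fin (n + 2))) [DecidablePred (σ.SameCycle 0)] :
    Finset.univ.filter (σ.SameCycle 0) = {0, 1} ↔ (σ 0 = 1 ∧ σ 1 = 0) := by
  constructor
  · intro h
    have hm : ∀ b, σ.SameCycle 0 b ↔ b = 0 ∨ b = 1 := by
      intro b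
      have := Finset.ext_iff.1 h b
      simpa using this
    have hf : ∀ b, σ.SameCycle 0 b → σ b ≠ b := by
      intro b hb he
      have e0 := hb.symm.eq_of_left he
      have e1 := (hb.symm.trans ((hm 1).2 (Or.inr rfl))).eq_of_left he
      simp [e0] at e1
    have h0 := (hm 0).2 (Or.inl rfl)
    have h1 := (hm 1).2 (Or.inr rfl)
    constructor
    · exact ((hm _).1 (Equiv.Perm.sameCycle_apply_right.2 h0)).resolve_left (hf 0 h0)
    · exact ((hm _).1 (Equiv.Perm.sameCycle_apply_right.2 h1)).resolve_right (hf 1 h1)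
  · rintro ⟨h0, h1⟩
    ext b
    simp only [Finset.mem_filter, Finset.mem_univ, true_and, Finset.mem_insert,
      Finset.mem_singleton]
    constructor
    · intro hb
      obtain ⟨k, rfl⟩ := hb.exists_nat_pow_eq
      induction k with
      | zero => simp
      | succ k ih =>
        rw [pow_succ', Equiv.Perm.mul_apply]
        rcases ih ⟨k, by simp⟩ with h | h
        · rw [h, h0]; simp
        · rw [h, h1]; simp
    · rintro (rfl | rfl)
      · exact Equiv.Perm.SameCycle.refl _ _
      · exact ⟨1, by simpa using h0⟩

/-- The surviving permutations consist of the 2-cycle on `{0, 1}`, of signed weight `-s²`, and any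
permutation of the other `n` points. -/
lemma signWeight_total_add_two (s : R) (n : ℕ) :
    (signWeight s).total (n + 2) = - s ^ 2 * (signWeight s).total n := by
  classical
  rw [CycleWeight.total, ← Finset.sum_filter_add_sum_filter_not Finset.univ
    (fun σ : Equiv.Perm (Fin (n + 2)) => Finset.univ.filter (σ.SameCycle 0) = {0, 1}),
    sum_signWeight_eq_zero s _ (fun σ => cycle_zero_eq_iff σ), add_zero]
  have h := (signWeight s).sum_cycle_eq (0 : Fin (n + 2)) {0, 1} (by simp)
  rw [Finset.card_pair (by simp), Nat.add_sub_cancel, signWeight_cyclic_two] at h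
  rw [← h]

lemma signWeight_total (s : R) (n : ℕ) :
    (signWeight s).total n = if Even n then (-1) ^ (n / 2) * s ^ n else 0 := by
  induction n using Nat.twoStepInduction with
  | zero => simp [signWeight_total_zero]
  | one => simp [signWeight_total_one]
  | more n ih _ =>
    rw [signWeight_total_add_two, ih, Nat.add_div_right n (by norm_num)]
    simp only [Nat.even_add, even_two, iff_true]
    split_ifs
    · ring
    · simp

variable [Algebra ℚ R]

lemma signWeight_totalGF (s : R) : (signWeight s).totalGF = cosS s := by
  ext n
  rw [CycleWeight.totalGF, coeff_mk, signWeight_total, cosS, coeff_rescale, cos, coeff_mk]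
  split_ifs
  · rw [div_eq_mul_one_div ((-1 : ℚ) ^ (n / 2)), map_mul, map_pow, map_neg, map_one]
    ring
  · simp

lemma signWeight_cyclicGF (s : R) :
    (signWeight s).cyclicGF = - (turnWeight 1 0 s).cyclicGF := by
  ext n
  rw [map_neg, CycleWeight.cyclicGF, CycleWeight.cyclicGF, coeff_mk, coeff_mk]
  cases n with
  | zero => simp
  | succ n => simp [signWeight_cyclic_succ]

/-- The weight `f` is visible only in degree one, and `x` occurs once per cycle. -/
lemma turnWeight_cyclicGF (x f s : R) :
    (turnWeight x f s).cyclicGF = C x * (C f * X + (turnWeight 1 0 s).cyclicGF) := by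
  ext n
  rw [coeff_C_mul, map_add, CycleWeight.cyclicGF, CycleWeight.cyclicGF, coeff_mk, coeff_mk,
    coeff_C_mul]
  rcases n with _ | _ | n
  · simp
  · simp [turnWeight_cyclic_succ x, turnWeight_cyclic_one]
  · rw [turnWeight_cyclic_succ x, turnWeight_cyclic_add_two f 0]
    simp [coeff_X]
    ring

lemma cosS_eq (s : R) : cosS s = (exp R).subst (-(turnWeight 1 0 s).cyclicGF) := by
  rw [← signWeight_totalGF, CycleWeight.totalGF_eq _ (signWeight_total_zero s),
    signWeight_cyclicGF]

lemma logOf_cosS (s : R) : logOf (cosS s) = -(turnWeight 1 0 s).cyclicGF := by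
  rw [cosS_eq, logOf_exp_subst]
  simp [CycleWeight.constantCoeff_cyclicGF]

lemma constantCoeff_cosS (s : R) : constantCoeff (cosS s) = 1 := by
  rw [cosS_eq, constantCoeff_exp_subst]
  simp [CycleWeight.constantCoeff_cyclicGF]

lemma logOf_secS (s : R) : logOf (secS s) = (turnWeight 1 0 s).cyclicGF := by
  have h0 := (turnWeight 1 0 s).constantCoeff_cyclicGF
  have h1 : cosS s * secS s = 1 := mul_invOfUnit _ _ (by simp [constantCoeff_cosS])
  have h2 := exp_subst_mul_exp_subst_neg h0
  rw [← cosS_eq] at h2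
  have h3 : secS s = (exp R).subst (turnWeight 1 0 s).cyclicGF := by
    calc secS s = (exp R).subst (turnWeight 1 0 s).cyclicGF * cosS s * secS s := by
          rw [h2, one_mul]
      _ = _ := by rw [mul_assoc, h1, mul_one]
  rw [h3, logOf_exp_subst h0]

end Weights

/-! ### Translating matches, `cdes` and `cyc` into local weights. -/

section Statistics
variable {n : ℕ} (σ : Equiv.Perm (Fin n))

lemma mem_cycleMins {c : Fin n} : c ∈ cycleMins σ ↔ ∀ b, σ.SameCycle c b → c ≤ b := by
  simp [cycleMins]

lemma cycleLength_pos (a : Fin n) : 0 < cycleLength σ a :=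
  Function.minimalPeriod_pos_of_mem_periodicPts
    (Function.Injective.mem_periodicPts σ.injective a)

lemma pow_cycleLength (a : Fin n) : (σ ^ cycleLength σ a) a = a := by
  rw [← Equiv.Perm.iterate_eq_pow]
  exact Function.iterate_minimalPeriod

lemma pow_injOn_cycleLength (a : Fin n) :
    Set.InjOn (fun i => (σ ^ i) a) (Finset.range (cycleLength σ a)) := by
  intro i hi j hj h
  simp only [Finset.coe_range, Set.mem_Iio] at hi hj
  exact Function.iterate_injOn_Iio_minimalPeriod (f := σ) hi hj h

lemma exists_pow_eq_of_sameCycle {a b : Fin n} (h : σ.SameCycle a b) :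
    ∃ i < cycleLength σ a, (σ ^ i) a = b := by
  obtain ⟨k, rfl⟩ := h.exists_nat_pow_eq
  exact ⟨k % cycleLength σ a, Nat.mod_lt _ (cycleLength_pos σ a),
    Function.iterate_mod_minimalPeriod_eq (f := σ)⟩

open Classical in
-- The summand `1` in `cdes` is the step from the last entry back to the minimum. It is always a
-- weak descent, and an equality exactly for a fixed point.
lemma cycleCdes_eq {c : Fin n} (hc : c ∈ cycleMins σ) :
    cycleCdes σ c = (Finset.univ.filter fun a => σ.SameCycle c a ∧ σ a ≤ a).card := by
  have hmin := (mem_cycleMins σ).1 hc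
  have hp := cycleLength_pos σ c
  have h1 : cycleCdes σ c = ((Finset.range (cycleLength σ c)).filter
      fun i => (σ ^ (i + 1)) c ≤ (σ ^ i) c).card := by
    obtain ⟨m, hm⟩ : ∃ m, cycleLength σ c = m + 1 := ⟨_, (Nat.succ_pred_eq_of_pos hp).symm⟩
    have hlast : (σ ^ (m + 1)) c ≤ (σ ^ m) c := by
      rw [← hm, pow_cycleLength]
      exact hmin _ ⟨m, by simp⟩
    rw [cycleCdes, hm, Nat.add_sub_cancel, Finset.range_add_one, Finset.filter_insert,
      if_pos hlast, Finset.card_insert_of_notMem (by simp), add_comm]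
    congr 2
    refine Finset.filter_congr fun i hi => ?_
    have hi' := Finset.mem_range.1 hi
    -- Before the closing step, consecutive entries differ, so weak and strict descents agree.
    refine ⟨le_of_lt, fun h => lt_of_le_of_ne h fun he => ?_⟩
    have := pow_injOn_cycleLength σ c (x₁ := i + 1) (x₂ := i)
      (by simp; omega) (by simp; omega) he
    omega
  rw [h1]
  refine Finset.card_bij (fun i _ => (σ ^ i) c) ?_ ?_ ?_
  · intro i hi
    have h := (Finset.mem_filter.1 hi).2
    simp only [Finset.mem_filter, Finset.mem_univ, true_and]
    rw [pow_succ', Equiv.Perm.mul_apply] at h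
    exact ⟨⟨i, by simp⟩, h⟩
  · intro i hi j hj h
    exact pow_injOn_cycleLength σ c (Finset.mem_coe.2 (Finset.mem_filter.1 hi).1)
      (Finset.mem_coe.2 (Finset.mem_filter.1 hj).1) h
  · intro a ha
    obtain ⟨hs, hd⟩ := (Finset.mem_filter.1 ha).2
    obtain ⟨i, hi, rfl⟩ := exists_pow_eq_of_sameCycle σ hs
    refine ⟨i, ?_, rfl⟩
    rw [Finset.mem_filter, pow_succ', Equiv.Perm.mul_apply]
    exact ⟨Finset.mem_range.2 hi, hd⟩

/-- `cdes` counts the `a` with `σ a ≤ a`. -/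
lemma cdes_eq : cdes σ = (Finset.univ.filter fun a => σ a ≤ a).card := by
  classical
  rw [cdes, Finset.sum_congr rfl fun c hc => cycleCdes_eq σ hc, ← Finset.card_biUnion]
  · congr 1
    ext a
    simp only [Finset.mem_biUnion, Finset.mem_filter, Finset.mem_univ, true_and]
    refine ⟨fun ⟨_, _, _, h⟩ => h, fun h => ?_⟩
    obtain ⟨c, hc, hmin⟩ := Finset.exists_min_image
      (Finset.univ.filter fun b => σ.SameCycle a b) id
      ⟨a, by simp [Equiv.Perm.SameCycle.refl]⟩
    simp only [Finset.mem_filter, Finset.mem_univ, true_and, id] at hc hmin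
    exact ⟨c, (mem_cycleMins σ).2 fun b hb => hmin b (hc.trans hb), hc.symm, h⟩
  · intro c hc d hd hne
    rw [Function.onFun, Finset.disjoint_left]
    intro a ha ha'
    have h1 := (Finset.mem_filter.1 ha).2.1
    have h2 := (Finset.mem_filter.1 ha').2.1
    have h3 := h1.trans h2.symm
    exact hne (le_antisymm ((mem_cycleMins σ).1 hc _ h3) ((mem_cycleMins σ).1 hd _ h3.symm))

lemma red_eq_id_iff (w : Fin 3 → Fin n) :
    (∀ i : Fin 3, red w i = ((1 : Equiv.Perm (Fin 3)) i : ℕ)) ↔ w 0 < w 1 ∧ w 1 < w 2 := by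
  simp only [red, Finset.card_filter, Fin.forall_fin_succ, Fin.sum_univ_three, lt_irrefl, if_false]
  simp only [Fin.lt_def]
  constructor
  · rintro ⟨h0, h1, h2, -⟩
    simp at h0 h1 h2
    split_ifs at h1 h2 <;> omega
  · rintro ⟨h0, h1⟩
    simp
    split_ifs <;> omega

lemma red_eq_rev_iff (w : Fin 3 → Fin n) :
    (∀ i : Fin 3, red w i = ((Fin.revPerm : Equiv.Perm (Fin 3)) i : ℕ)) ↔
      w 1 < w 0 ∧ w 2 < w 1 := by
  simp only [red, Finset.card_filter, Fin.forall_fin_succ, Fin.sum_univ_three, lt_irrefl, if_false]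
  simp only [Fin.lt_def]
  constructor
  · rintro ⟨h0, h1, h2, -⟩
    simp at h0 h1 h2
    split_ifs at h0 h1 h2 <;> omega
  · rintro ⟨h0, h1⟩
    simp
    split_ifs <;> omega

lemma three_le_cycleLength {a : Fin n} (h1 : σ a ≠ a) (h2 : σ (σ a) ≠ a) :
    3 ≤ cycleLength σ a := by
  by_contra h
  have hp := cycleLength_pos σ a
  have hpow := pow_cycleLength σ a
  obtain h | h : cycleLength σ a = 1 ∨ cycleLength σ a = 2 := by omega
  · rw [h] at hpow
    exact h1 (by simpa using hpow)
  · rw [h, sq] at hpow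
    exact h2 hpow

/-- The length condition is automatic: a monotone triple `a, σ a, σ (σ a)` has `σ a ≠ a` and `σ (σ
a) ≠ a`. -/
lemma not_hasCycleMatch_iff :
    ¬ HasCycleMatch pat123_321 σ ↔ ∀ a, σ a = a ∨ IsTurn σ a := by
  have hmatch : HasCycleMatch pat123_321 σ ↔
      ∃ a, 3 ≤ cycleLength σ a ∧ ((a < σ a ∧ σ a < σ (σ a)) ∨ (σ a < a ∧ σ (σ a) < σ a)) := by
    simp only [HasCycleMatch, pat123_321, Set.mem_insert_iff, Set.mem_singleton_iff,
      exists_eq_or_imp, exists_eq_left, red_eq_id_iff, red_eq_rev_iff]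
    simp [sq]
  rw [hmatch, not_exists]
  refine forall_congr' fun a => ?_
  rw [IsTurn]
  constructor
  · intro h
    by_contra hc
    obtain ⟨hf, ht⟩ := not_or.1 hc
    obtain ⟨ht1, ht2⟩ := not_or.1 ht
    have hf2 : σ (σ a) ≠ σ a := fun h' => hf (σ.injective h')
    rcases lt_or_gt_of_ne hf with hlt | hlt
    · have h2 : σ (σ a) < σ a := lt_of_le_of_ne (not_lt.1 fun h' => ht2 ⟨hlt, h'⟩) hf2
      exact h ⟨three_le_cycleLength σ hf (h2.trans hlt).ne, Or.inr ⟨hlt, h2⟩⟩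
    · have h2 : σ a < σ (σ a) := lt_of_le_of_ne (not_lt.1 fun h' => ht1 ⟨hlt, h'⟩) hf2.symm
      exact h ⟨three_le_cycleLength σ hf (hlt.trans h2).ne', Or.inl ⟨hlt, h2⟩⟩
  · rintro h ⟨-, hm⟩
    rcases h with h | h
    · rcases hm with hm | hm
      · exact hm.1.ne' h
      · exact hm.1.ne h
    · rcases hm with hm | hm <;> rcases h with h | h
      · exact lt_asymm h.2 hm.2
      · exact lt_asymm h.1 hm.1
      · exact lt_asymm h.1 hm.1
      · exact lt_asymm h.2 hm.2

variable {σ}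

/-- At a turn an ascent is followed by a descent and conversely, so `σ` injects either set into the
other. -/
lemma card_descents_eq_card_ascents (h : ∀ a, σ a = a ∨ IsTurn σ a) :
    (Finset.univ.filter fun a => σ a < a).card = (Finset.univ.filter fun a => a < σ a).card := by
  apply le_antisymm
  · refine Finset.card_le_card_of_injOn σ ?_ σ.injective.injOn
    intro a ha
    have ha' : σ a < a := by simpa using ha
    rcases (h a).resolve_left ha'.ne with h' | h'
    · exact absurd h'.1 ha'.not_gt
    · simpa using h'.2
  · refine Finset.card_le_card_of_injOn σ ?_ σ.injective.injOn
    intro a ha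
    have ha' : a < σ a := by simpa using ha
    rcases (h a).resolve_left ha'.ne' with h' | h'
    · simpa using h'.2
    · exact absurd h'.1 ha'.not_gt

variable {R : Type*} [CommRing R]

lemma prod_minWt (x : R) : ∏ a, minWt x σ a = x ^ cyc σ := by
  rw [cyc, cycleMins, ← Finset.prod_const, Finset.prod_filter]
  refine Finset.prod_congr rfl fun a _ => ?_
  rw [minWt]
  congr

lemma prod_turnWt (s : R) (h : ∀ a, σ a = a ∨ IsTurn σ a) :
    ∏ a, turnWt (s ^ 2) s σ a = (s ^ 2) ^ cdes σ := by
  -- A fixed point satisfies both inequalities and receives `s * s`; a turn satisfies exactly one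
  -- and receives `s`.
  have hfac : ∀ a, turnWt (s ^ 2) s σ a =
      (if σ a ≤ a then s else 1) * (if a ≤ σ a then s else 1) := by
    intro a
    rcases lt_trichotomy (σ a) a with hlt | heq | hlt
    · simp [turnWt, hlt.ne, (h a).resolve_left hlt.ne, hlt.le, hlt.not_ge]
    · simp [turnWt, heq, sq]
    · simp [turnWt, hlt.ne', (h a).resolve_left hlt.ne', hlt.le, hlt.not_ge]
  have hd : (Finset.univ.filter fun a => a ≤ σ a).card =
      (Finset.univ.filter fun a => σ a ≤ a).card := by
    have h1 := Finset.card_filter_add_card_filter_not (s := Finset.univ) (fun a => a ≤ σ a)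
    have h2 := Finset.card_filter_add_card_filter_not (s := Finset.univ) (fun a => σ a ≤ a)
    simp only [not_le] at h1 h2
    have h3 := card_descents_eq_card_ascents h
    omega
  rw [Finset.prod_congr rfl fun a _ => hfac a, Finset.prod_mul_distrib, Finset.prod_ite,
    Finset.prod_ite]
  simp only [Finset.prod_const, one_pow, mul_one]
  rw [hd, cdes_eq, ← pow_add, ← pow_mul, two_mul]

open Classical in
lemma turnWeight_wt (x s : R) :
    (turnWeight x (s ^ 2) s).wt σ =
      if HasCycleMatch pat123_321 σ then 0 else x ^ cyc σ * (s ^ 2) ^ cdes σ := by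
  split_ifs with h
  · have h' : ¬ ∀ a, σ a = a ∨ IsTurn σ a := fun h' => (not_hasCycleMatch_iff σ).2 h' h
    push Not at h'
    obtain ⟨a, h1, h2⟩ := h'
    exact mul_eq_zero_of_right _
      (Finset.prod_eq_zero (Finset.mem_univ a) (by simp [turnWt, h1, h2]))
  · rw [← prod_turnWt s ((not_hasCycleMatch_iff σ).1 h), ← prod_minWt]
    rfl

lemma cyc_eq_one_iff {σ : Equiv.Perm (Fin (n + 1))} : cyc σ = 1 ↔ IsTransitive σ := by
  classical
  rw [cyc, Finset.card_eq_one]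
  constructor
  · rintro ⟨c, hc⟩
    have key : ∀ a, σ.SameCycle a c := by
      intro a
      obtain ⟨d, hd, hmin⟩ := Finset.exists_min_image
        (Finset.univ.filter fun b => σ.SameCycle a b) id
        ⟨a, by simp [Equiv.Perm.SameCycle.refl]⟩
      simp only [Finset.mem_filter, Finset.mem_univ, true_and, id] at hd hmin
      have : d ∈ cycleMins σ := (mem_cycleMins σ).2 fun b hb => hmin b (hd.trans hb)
      rw [hc, Finset.mem_singleton] at this
      exact this ▸ hd
    exact fun a b => (key a).trans (key b).symm
  · intro h
    refine ⟨0, ?_⟩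
    ext a
    rw [mem_cycleMins, Finset.mem_singleton]
    refine ⟨fun ha => Fin.le_zero_iff.1 (ha 0 (h _ _)), ?_⟩
    rintro rfl b -
    exact Fin.zero_le b

variable [Algebra ℚ R]

lemma NCM_eq_totalGF (x s : R) : NCM pat123_321 x (s ^ 2) = (turnWeight x (s ^ 2) s).totalGF := by
  classical
  ext n
  rw [NCM, CycleWeight.totalGF, coeff_mk, coeff_mk, CycleWeight.total, ncmS]
  congr 1
  simp only [turnWeight_wt, Finset.sum_filter, ite_not]

lemma cycleNCM_eq_cyclicGF (s : R) :
    cycleNCM pat123_321 (s ^ 2) = (turnWeight 1 (s ^ 2) s).cyclicGF := by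
  classical
  ext n
  rw [cycleNCM, CycleWeight.cyclicGF, coeff_mk, coeff_mk]
  cases n with
  -- The empty permutation is vacuously transitive but has no cycle, so degree zero is separate.
  | zero =>
    have h : ∀ σ : Equiv.Perm (Fin 0), cyc σ ≠ 1 := fun σ => by
      simp [cyc, Finset.eq_empty_of_isEmpty]
    simp [ncmL, h]
  | succ n =>
    rw [if_neg n.succ_ne_zero, CycleWeight.cyclic, ncmL, ncmS]
    congr 1
    simp only [turnWeight_wt, one_pow, one_mul, cyc_eq_one_iff, Finset.sum_filter, ite_not]
    refine Finset.sum_congr rfl fun σ _ => ?_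
    split_ifs <;> rfl

end Statistics
end CyclePattern

/-! ### The two generating functions. -/

theorem mainTheorem8 {R : Type*} [CommRing R] [Algebra ℚ R] (x y s : R) (hs : s ^ 2 = y) :
    CyclePattern.cycleNCM CyclePattern.pat123_321 y =
        PowerSeries.C y * PowerSeries.X - PowerSeries.logOf (CyclePattern.cosS s) ∧
      CyclePattern.NCM CyclePattern.pat123_321 x y =
        PowerSeries.rescale (x * y) (PowerSeries.exp R) *
          CyclePattern.fpow (CyclePattern.secS s) x := by
  subst hs
  constructor
  · rw [CyclePattern.cycleNCM_eq_cyclicGF, CyclePattern.turnWeight_cyclicGF,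
      CyclePattern.logOf_cosS, map_one, one_mul, sub_neg_eq_add]
  · rw [CyclePattern.NCM_eq_totalGF,
      CyclePattern.CycleWeight.totalGF_eq _ (CyclePattern.turnWeight_total_zero _ _ _),
      CyclePattern.turnWeight_cyclicGF, CyclePattern.fpow, CyclePattern.logOf_secS, mul_add,
      CyclePattern.exp_subst_add, CyclePattern.rescale_exp_eq_subst, map_mul, mul_assoc]
    · simp
    · simp [CyclePattern.CycleWeight.constantCoeff_cyclicGF]
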